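/- Let $K$ be an algebraically closed field and $\Lambda$ a finite-dimensional $K$-algebra; all modules are finitely generated left $\Lambda$-modules unless said otherwise. Write $\mathbb{D}=\operatorname{Hom}_K(-,K)$; in particular $\mathbb{D}\Lambda$ is a left $\Lambda$-module via $(a\varphi)(x)=\varphi(xa)$. For a module $M$ with minimal projective presentation $P_1\to P_0\to M\to 0$ let $\operatorname{Tr}M=\operatorname{Coker}(\operatorname{Hom}_\Lambda(P_0,\Lambda)\to\operatorname{Hom}_\Lambda(P_1,\Lambda))$ (similarly for right modules), and let $\tau M=\mathbb{D}\operatorname{Tr}M$, $\tau^{-1}M=\operatorname{Tr}\mathbb{D}M$. A module $M$ is called - *$\tau$-rigid* if $\operatorname{Hom}_\Lambda(M,\tau M)=0$, and *$\tau^{-1}$-rigid* if $\operatorname{Hom}_\Lambda(\tau^{-1}M,M)=0$; - *semi-Gorenstein projective* if $\operatorname{Ext}^i_\Lambda(M,\Lambda)=0$ for all $i\ge 1$, and *semi-Gorenstein injective* if $\operatorname{Ext}^i_\Lambda(\mathbb{D}\Lambda,M)=0$ for all $i\ge1$; - *Gorenstein projective* if there is an exact sequence $\cdots\to P_{-1}\to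 P_0\to P_1\to\cdots$ of finitely generated projective modules which stays exact under $\operatorname{Hom}_\Lambda(-,\Lambda)$ and satisfies $M\cong\operatorname{Im}(P_{-1}\to P_0)$; - *Gorenstein injective* if there is an exact sequence $\cdots\to I_{-1}\to I_0\to I_1\to\cdots$ of finitely generated injective modules which stays exact under $\operatorname{Hom}_\Lambda(\mathbb{D}\Lambda,-)$ and satisfies $M\cong\operatorname{Im}(I_{-1}\to I_0)$; - *tilting* if $\operatorname{pd}M\le1$, $\operatorname{Ext}^1_\Lambda(M,M)=0$ and there is an exact sequence $0\to\Lambda\to T_0\to T_1\to0$ with $T_0,T_1\in\operatorname{add}M$; - *cotilting* if $\operatorname{id}M\le1$, $\operatorname{Ext}^1_\Lambda(M,M)=0$ and there is an exact sequence $0\to T_1\to T_0\to\mathbb{D}\Lambda\to0$ with $T_0,T_1\in\operatorname{add}M$. Here $\operatorname{add}M$ is the class of direct summands of finite direct sums of copies of $M$. The following are equivalent. 1. $\Lambda$ is self-injective, i.e. injective as a left $\Lambda$-module. 2. $\mathbb{D}\Lambda$ is semi-Gorenstein projective and $\tau$-rigid. 3. Every cotilting module is semi-Gorenstein projective and $\tau$-rigid.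 4. $\mathbb{D}\Lambda$ is Gorenstein projective. 5. Every cotilting module is Gorenstein projective. 6. $\Lambda$ is semi-Gorenstein injective and $\tau^{-1}$-rigid. 7. Every tilting module is semi-Gorenstein injective and $\tau^{-1}$-rigid. 8. $\Lambda$ is Gorenstein injective. 9. Every tilting module is Gorenstein injective. -/

import Mathlib

open CategoryTheory

universe u

noncomputable section

namespace FDAlg

/-! ### The `K`-duality `𝔻 = Hom_K(-, K)` -/

/-- The `K`-dual `𝔻 N = Hom_K(N, K)`. Right modules over a ring `S` are modules over `Sᵐᵒᵖ`;
the dual of a left (right) `S`-module is a right (left) `S`-module, see the instances below. -/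
def KDual (K N : Type u) [Field K] [AddCommGroup N] [Module K N] : Type u := N →ₗ[K] K

section KDual

variable (K N : Type u) [Field K] [AddCommGroup N] [Module K N]

instance : AddCommGroup (KDual K N) := inferInstanceAs (AddCommGroup (N →ₗ[K] K))

instance : FunLike (KDual K N) N K := inferInstanceAs (FunLike (N →ₗ[K] K) N K)

/-- For a right `S`-module `N`, the left `S`-action on `𝔻 N` is `(a • φ) n = φ (n a)`. -/
instance KDual.leftModule (S : Type u) [Ring S] [Module Sᵐᵒᵖ N] [SMulCommClass Sᵐᵒᵖ K N] :
    Module S (KDual K N) where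
  smul a φ := LinearMap.comp (show N →ₗ[K] K from φ)
    (DistribSMul.toLinearMap K N (MulOpposite.op a))
  one_smul φ := LinearMap.ext fun n =>
    congrArg (show N →ₗ[K] K from φ) (one_smul Sᵐᵒᵖ n)
  mul_smul a b φ := LinearMap.ext fun n =>
    congrArg (show N →ₗ[K] K from φ) (mul_smul (MulOpposite.op b) (MulOpposite.op a) n)
  smul_zero _ := rfl
  smul_add _ _ _ := rfl
  add_smul a b φ := LinearMap.ext fun n =>
    (congrArg (show N →ₗ[K] K from φ) (add_smul (MulOpposite.op a) (MulOpposite.op b) n)).trans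
      (map_add (show N →ₗ[K] K from φ) _ _)
  zero_smul φ := LinearMap.ext fun n =>
    (congrArg (show N →ₗ[K] K from φ) (zero_smul Sᵐᵒᵖ n)).trans
      (map_zero (show N →ₗ[K] K from φ))

/-- For a left `S`-module `N`, the right `S`-action on `𝔻 N` is `(φ a) n = φ (a n)`. -/
instance KDual.rightModule (S : Type u) [Ring S] [Module S N] [SMulCommClass S K N] :
    Module Sᵐᵒᵖ (KDual K N) where
  smul a φ := LinearMap.comp (show N →ₗ[K] K from φ)
    (DistribSMul.toLinearMap K N (MulOpposite.unop a))
  one_smul φ := LinearMap.ext fun n =>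
    congrArg (show N →ₗ[K] K from φ) (one_smul S n)
  mul_smul a b φ := LinearMap.ext fun n =>
    congrArg (show N →ₗ[K] K from φ) (mul_smul (MulOpposite.unop b) (MulOpposite.unop a) n)
  smul_zero _ := rfl
  smul_add _ _ _ := rfl
  add_smul a b φ := LinearMap.ext fun n =>
    (congrArg (show N →ₗ[K] K from φ)
      (add_smul (MulOpposite.unop a) (MulOpposite.unop b) n)).trans
      (map_add (show N →ₗ[K] K from φ) _ _)
  zero_smul φ := LinearMap.ext fun n =>
    (congrArg (show N →ₗ[K] K from φ) (zero_smul S n)).trans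
      (map_zero (show N →ₗ[K] K from φ))

instance KDual.baseModule : Module K (KDual K N) := inferInstanceAs (Module K (N →ₗ[K] K))

variable {K N}

theorem KDual.left_smul_apply {S : Type u} [Ring S] [Module Sᵐᵒᵖ N] [SMulCommClass Sᵐᵒᵖ K N]
    (a : S) (φ : KDual K N) (n : N) : (a • φ) n = φ (MulOpposite.op a • n) := rfl

theorem KDual.right_smul_apply {S : Type u} [Ring S] [Module S N] [SMulCommClass S K N]
    (a : S) (φ : KDual K N) (n : N) : (MulOpposite.op a • φ) n = φ (a • n) := rfl

variable (K N)

/-- The dual of a finitely generated left module is a finitely generated right module. -/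
instance KDual.finite_right (Λ : Type u) [Ring Λ] [Algebra K Λ] [Module.Finite K Λ]
    [Module Λ N] [IsScalarTower K Λ N] [Module.Finite Λ N] :
    Module.Finite Λᵐᵒᵖ (KDual K N) := by
  have : Module.Finite K N := Module.Finite.trans Λ N
  have : Module.Finite K (KDual K N) := inferInstanceAs (Module.Finite K (N →ₗ[K] K))
  have : IsScalarTower K Λᵐᵒᵖ (KDual K N) := ⟨fun k a φ => LinearMap.ext fun n => by
    change (show N →ₗ[K] K from φ) ((k • MulOpposite.unop a) • n)
      = k • (show N →ₗ[K] K from φ) (MulOpposite.unop a • n)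
    rw [smul_assoc, map_smul]⟩
  exact Module.Finite.of_restrictScalars_finite K Λᵐᵒᵖ (KDual K N)

end KDual

/-! ### Minimal projective presentations -/

/-- A submodule `N` of `M` is superfluous (small) if `N + L = M` forces `L = M`. -/
def IsSuperfluous {A M : Type u} [Ring A] [AddCommGroup M] [Module A M]
    (N : Submodule A M) : Prop :=
  ∀ L : Submodule A M, N ⊔ L = ⊤ → L = ⊤

/-- A minimal projective presentation `P₁ → P₀ → M → 0` by finitely generated projectives:
the sequence is exact, and `P₀ → M` and `P₁ → Im (P₁ → P₀)` are projective covers. -/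
structure MinProjPres (A M : Type u) [Ring A] [AddCommGroup M] [Module A M] where
  P₁ : ModuleCat.{u} A
  P₀ : ModuleCat.{u} A
  d₁ : P₁ →ₗ[A] P₀
  d₀ : P₀ →ₗ[A] M
  finite₁ : Module.Finite A P₁
  finite₀ : Module.Finite A P₀
  projective₁ : Module.Projective A P₁
  projective₀ : Module.Projective A P₀
  exact : Function.Exact d₁ d₀
  surjective : Function.Surjective d₀
  superfluous₁ : IsSuperfluous (LinearMap.ker d₁)
  superfluous₀ : IsSuperfluous (LinearMap.ker d₀)

/-- Finitely generated modules over a left artinian ring have projective covers. -/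
theorem exists_projectiveCover (A M : Type u) [Ring A] [IsArtinianRing A] [AddCommGroup M]
    [Module A M] [Module.Finite A M] :
    ∃ (P : ModuleCat.{u} A) (f : P →ₗ[A] M), Module.Finite A P ∧ Module.Projective A P ∧
      Function.Surjective f ∧ IsSuperfluous (LinearMap.ker f) := by
  obtain ⟨n, p, hp⟩ := Module.Finite.exists_fin' A M
  let S : Set (Submodule A (Fin n → A)) :=
    {N | Module.Projective A N ∧ Function.Surjective (p.comp N.subtype)}
  have hS : S.Nonempty := by
    refine ⟨⊤, Module.Projective.of_equiv (Submodule.topEquiv (R := A)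
      (M := Fin n → A)).symm, fun m => ?_⟩
    obtain ⟨x, hx⟩ := hp m
    exact ⟨⟨x, trivial⟩, hx⟩
  obtain ⟨N, ⟨hNp, hNs⟩, hmin⟩ := IsArtinian.set_has_minimal S hS
  refine ⟨ModuleCat.of A N, p.comp N.subtype, inferInstanceAs (Module.Finite A N), hNp, hNs, ?_⟩
  intro L hL
  change Submodule A N at L
  have hLs : Function.Surjective ((p.comp N.subtype).comp L.subtype) := by
    intro m
    obtain ⟨x, hx⟩ := hNs m
    have hxt : x ∈ LinearMap.ker (p.comp N.subtype) ⊔ L := hL ▸ (trivial : x ∈ ⊤)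
    obtain ⟨y, hy, z, hz, hyz⟩ := Submodule.mem_sup.1 hxt
    refine ⟨⟨z, hz⟩, ?_⟩
    rw [← hx, ← hyz, map_add, LinearMap.mem_ker.1 hy, zero_add]
    rfl
  obtain ⟨g, hg⟩ := Module.projective_lifting_property
    ((p.comp N.subtype).comp L.subtype) (p.comp N.subtype) hLs
  let e : Module.End A N := L.subtype.comp g
  have he : ∀ x, (p.comp N.subtype) (e x) = (p.comp N.subtype) x :=
    fun x => LinearMap.congr_fun hg x
  have hek : ∀ k x, (p.comp N.subtype) ((e ^ k) x) = (p.comp N.subtype) x := by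
    intro k
    induction k with
    | zero => intro x; rfl
    | succ k ih =>
      intro x
      rw [pow_succ, Module.End.mul_apply, ih, he]
  obtain ⟨k, hk⟩ := Filter.eventually_atTop.1 (LinearMap.eventually_isCompl_ker_pow_range_pow e)
  have hc := hk (k + 1) (Nat.le_succ k)
  let R : Submodule A N := LinearMap.range (e ^ (k + 1))
  have hRL : R ≤ L := by
    rintro _ ⟨x, rfl⟩
    rw [pow_succ', Module.End.mul_apply]
    exact (g ((e ^ k) x)).2
  have hRp : Module.Projective A R :=
    Module.Projective.of_split R.subtype (Submodule.projectionOnto R _ hc.symm)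
      (LinearMap.ext fun x => Submodule.projectionOnto_apply_left hc.symm x)
  have hmem : R.map N.subtype ∈ S := by
    refine ⟨Module.Projective.of_equiv
      (Submodule.equivMapOfInjective N.subtype N.injective_subtype R), fun m => ?_⟩
    obtain ⟨x, hx⟩ := hNs m
    exact ⟨⟨_, Submodule.mem_map_of_mem ⟨x, rfl⟩⟩, (hek (k + 1) x).trans hx⟩
  have hnot := hmin _ hmem
  have hle : R.map N.subtype ≤ N := Submodule.map_subtype_le N R
  have heq : R.map N.subtype = N := by
    by_contra hne
    exact hnot (lt_of_le_of_ne hle hne)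
  have hR : R = ⊤ := by
    apply Submodule.map_injective_of_injective N.injective_subtype
    rw [heq, Submodule.map_subtype_top]
  exact top_le_iff.1 (hR ▸ hRL)

theorem nonempty_minProjPres (A M : Type u) [Ring A] [IsArtinianRing A] [AddCommGroup M]
    [Module A M] [Module.Finite A M] : Nonempty (MinProjPres A M) := by
  obtain ⟨P₀, d₀, hf₀, hp₀, hs₀, hk₀⟩ := exists_projectiveCover A M
  obtain ⟨P₁, d, hf₁, hp₁, hs₁, hk₁⟩ := exists_projectiveCover A (LinearMap.ker d₀)
  refine ⟨⟨P₁, P₀, (LinearMap.ker d₀).subtype.comp d, d₀, hf₁, hf₀, hp₁, hp₀, ?_, hs₀, ?_, hk₀⟩⟩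
  · rw [LinearMap.exact_iff, LinearMap.range_comp, LinearMap.range_eq_top.2 hs₁,
      Submodule.map_subtype_top]
  · rw [LinearMap.ker_comp_of_ker_eq_bot _ (Submodule.ker_subtype _)]
    exact hk₁

/-- A chosen minimal projective presentation (unique up to isomorphism) of a finitely generated
module over a finite-dimensional algebra. -/
def minProjPres (K A M : Type u) [Field K] [Ring A] [Algebra K A] [Module.Finite K A]
    [AddCommGroup M] [Module A M] [Module.Finite A M] : MinProjPres A M :=
  haveI : IsArtinianRing A := IsArtinianRing.of_finite K A
  Classical.choice (nonempty_minProjPres A M)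

/-! ### The transpose and the Auslander-Reiten translations -/

/-- For an `A`-linear map `f : P₁ → P₀` and `R` with commuting actions of `A` and `B`, the
`B`-module `Coker (Hom_A(P₀, R) → Hom_A(P₁, R))`. -/
abbrev TransposeOf (A B R : Type u) [Ring A] [Ring B] [AddCommGroup R] [Module A R] [Module B R]
    [SMulCommClass A B R] {P₁ P₀ : Type u} [AddCommGroup P₁] [AddCommGroup P₀] [Module A P₁]
    [Module A P₀] (f : P₁ →ₗ[A] P₀) : Type u :=
  (P₁ →ₗ[A] R) ⧸ LinearMap.range (LinearMap.lcomp B R f)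

section AuslanderReiten

variable (K Λ : Type u) [Field K] [Ring Λ] [Algebra K Λ] [Module.Finite K Λ]

/-- The transpose `Tr M` of a left `Λ`-module: a right `Λ`-module. -/
abbrev TrLeft (M : Type u) [AddCommGroup M] [Module Λ M] [Module.Finite Λ M] : Type u :=
  TransposeOf Λ Λᵐᵒᵖ Λ (minProjPres K Λ M).d₁

/-- The transpose `Tr N` of a right `Λ`-module: a left `Λ`-module. -/
abbrev TrRight (N : Type u) [AddCommGroup N] [Module Λᵐᵒᵖ N] [Module.Finite Λᵐᵒᵖ N] : Type u :=
  TransposeOf Λᵐᵒᵖ Λ Λ (minProjPres K Λᵐᵒᵖ N).d₁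

/-- The Auslander-Reiten translation `τ M = 𝔻 Tr M`. -/
abbrev Tau (M : Type u) [AddCommGroup M] [Module Λ M] [Module.Finite Λ M] : Type u :=
  KDual K (TrLeft K Λ M)

/-- The inverse Auslander-Reiten translation `τ⁻¹ M = Tr 𝔻 M`. -/
abbrev TauInv (M : Type u) [AddCommGroup M] [Module K M] [Module Λ M] [IsScalarTower K Λ M]
    [Module.Finite Λ M] : Type u :=
  TrRight K Λ (KDual K M)

/-- `M` is `τ`-rigid: `Hom_Λ(M, τ M) = 0`. -/
def IsTauRigid (M : Type u) [AddCommGroup M] [Module Λ M] [Module.Finite Λ M] : Prop :=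
  ∀ g : M →ₗ[Λ] Tau K Λ M, g = 0

/-- `M` is `τ⁻¹`-rigid: `Hom_Λ(τ⁻¹ M, M) = 0`. -/
def IsTauInvRigid (M : Type u) [AddCommGroup M] [Module K M] [Module Λ M] [IsScalarTower K Λ M]
    [Module.Finite Λ M] : Prop :=
  ∀ g : TauInv K Λ M →ₗ[Λ] M, g = 0

/-! ### The injective cogenerator `𝔻Λ` -/

/-- `𝔻Λ`, with its left `Λ`-action `(a • φ) x = φ (x a)`. -/
abbrev DReg : Type u := KDual K Λ

instance DReg.isScalarTower : IsScalarTower K Λ (DReg K Λ) :=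
  ⟨fun k a φ => LinearMap.ext fun x => by
    change (show Λ →ₗ[K] K from φ) (x * (k • a)) = k • (show Λ →ₗ[K] K from φ) (x * a)
    rw [mul_smul_comm, map_smul]⟩

instance DReg.finite : Module.Finite Λ (DReg K Λ) :=
  haveI : Module.Finite K (DReg K Λ) := inferInstanceAs (Module.Finite K (Λ →ₗ[K] K))
  Module.Finite.of_restrictScalars_finite K Λ (DReg K Λ)

end AuslanderReiten

/-! ### Gorenstein projective and Gorenstein injective modules -/

section Homological

variable (Λ : Type u) [Ring Λ]

/-- `M` is Gorenstein projective: there is an exact sequence `⋯ → P₋₁ → P₀ → P₁ → ⋯` of finitely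
generated projective modules that stays exact under `Hom_Λ(-, Λ)`, with `M ≅ Im (P₋₁ → P₀)`. -/
def IsGorensteinProjective (M : Type u) [AddCommGroup M] [Module Λ M] : Prop :=
  ∃ (P : ℤ → ModuleCat.{u} Λ) (d : ∀ i, P i →ₗ[Λ] P (i + 1)),
    (∀ i, Module.Finite Λ (P i) ∧ Module.Projective Λ (P i)) ∧
    (∀ i, Function.Exact (d i) (d (i + 1))) ∧
    (∀ i, Function.Exact (fun φ : P (i + 1 + 1) →ₗ[Λ] Λ => φ.comp (d (i + 1)))
      (fun φ : P (i + 1) →ₗ[Λ] Λ => φ.comp (d i))) ∧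
    Nonempty (M ≃ₗ[Λ] LinearMap.range (d (-1)))

/-- `M` is Gorenstein injective: there is an exact sequence `⋯ → I₋₁ → I₀ → I₁ → ⋯` of finitely
generated injective modules that stays exact under `Hom_Λ(𝔻Λ, -)`, with `M ≅ Im (I₋₁ → I₀)`. -/
def IsGorensteinInjective (K : Type u) [Field K] [Algebra K Λ]
    (M : Type u) [AddCommGroup M] [Module Λ M] : Prop :=
  ∃ (I : ℤ → ModuleCat.{u} Λ) (d : ∀ i, I i →ₗ[Λ] I (i + 1)),
    (∀ i, Module.Finite Λ (I i) ∧ Module.Injective Λ (I i)) ∧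
    (∀ i, Function.Exact (d i) (d (i + 1))) ∧
    (∀ i, Function.Exact (fun φ : DReg K Λ →ₗ[Λ] I i => (d i).comp φ)
      (fun φ : DReg K Λ →ₗ[Λ] I (i + 1) => (d (i + 1)).comp φ)) ∧
    Nonempty (M ≃ₗ[Λ] LinearMap.range (d (-1)))

/-- `Ext_Λ^i(M, N) = 0`. -/
def ExtVanishes (M N : Type u) [AddCommGroup M] [Module Λ M] [AddCommGroup N] [Module Λ N]
    (i : ℕ) : Prop :=
  Subsingleton (Abelian.Ext.{u} (ModuleCat.of Λ M) (ModuleCat.of Λ N) i)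

/-- `M` is semi-Gorenstein projective: `Ext_Λ^i(M, Λ) = 0` for all `i ≥ 1`. -/
def IsSemiGorensteinProjective (M : Type u) [AddCommGroup M] [Module Λ M] : Prop :=
  ∀ i : ℕ, 1 ≤ i → ExtVanishes Λ M Λ i

/-- `N` is semi-Gorenstein injective: `Ext_Λ^i(𝔻Λ, N) = 0` for all `i ≥ 1`. -/
def IsSemiGorensteinInjective (K : Type u) [Field K] [Algebra K Λ]
    (N : Type u) [AddCommGroup N] [Module Λ N] : Prop :=
  ∀ i : ℕ, 1 ≤ i → ExtVanishes Λ (DReg K Λ) N i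

/-! ### Tilting and cotilting modules -/

/-- `X` lies in `add T`: it is a direct summand of a finite direct sum of copies of `T`. -/
def InAdd (T X : Type u) [AddCommGroup T] [Module Λ T] [AddCommGroup X] [Module Λ X] : Prop :=
  ∃ (n : ℕ) (s : X →ₗ[Λ] (Fin n → T)) (r : (Fin n → T) →ₗ[Λ] X), r.comp s = LinearMap.id

/-- A (classical) tilting module: finitely generated, `pd T ≤ 1`, `Ext¹(T, T) = 0`, and there is
an exact sequence `0 → Λ → T₀ → T₁ → 0` with `T₀, T₁` in `add T`. -/
structure IsTilting (T : Type u) [AddCommGroup T] [Module Λ T] : Prop where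
  finite : Module.Finite Λ T
  projDim_le_one : HasProjectiveDimensionLE (ModuleCat.of Λ T) 1
  ext_one : ExtVanishes Λ T T 1
  exists_coresolution : ∃ (T₀ T₁ : ModuleCat.{u} Λ) (f : Λ →ₗ[Λ] T₀) (g : T₀ →ₗ[Λ] T₁),
    InAdd Λ T T₀ ∧ InAdd Λ T T₁ ∧
      Function.Injective f ∧ Function.Exact f g ∧ Function.Surjective g

/-- A (classical) cotilting module: finitely generated, `id T ≤ 1`, `Ext¹(T, T) = 0`, and there is
an exact sequence `0 → T₁ → T₀ → 𝔻Λ → 0` with `T₀, T₁` in `add T`. -/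
structure IsCotilting (K : Type u) [Field K] [Algebra K Λ]
    (T : Type u) [AddCommGroup T] [Module Λ T] : Prop where
  finite : Module.Finite Λ T
  injDim_le_one : HasInjectiveDimensionLE (ModuleCat.of Λ T) 1
  ext_one : ExtVanishes Λ T T 1
  exists_resolution : ∃ (T₁ T₀ : ModuleCat.{u} Λ) (f : T₁ →ₗ[Λ] T₀) (g : T₀ →ₗ[Λ] DReg K Λ),
    InAdd Λ T T₀ ∧ InAdd Λ T T₁ ∧
      Function.Injective f ∧ Function.Exact f g ∧ Function.Surjective g

end Homological

end FDAlg

end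

open FDAlg

/-! The pivot is that `Λ` is injective if and only if `𝔻Λ` is projective. Finitely generated
projectives form `add Λ` and finitely generated injectives form `add 𝔻Λ`, so this says that an
inclusion between these classes in either direction forces equality. Instead of counting
indecomposable summands, the proof iterates the Nakayama functor `N = 𝔻 Hom(-, Λ)`, for which `N Λ ≅
𝔻Λ`. If `𝔻Λ` is projective, the classes `add (N^k Λ)` decrease and consist of projectives. Trace
ideals detect inclusions between such classes, so the descending chain condition gives `N^n Λ ∈ add
(N^(n+1) Λ)` for some `n`. Since `N` reflects such inclusions on projectives, this descends to `Λ ∈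
add 𝔻Λ` (`memAdd_of_preserves_of_reflects`, `regular_memAdd_dReg`). The converse is the same
statement for the opposite algebra.

Rigidity enters through projective dimension: `Hom(𝔻Λ, τ𝔻Λ) = 0` makes the minimal presentation of
`𝔻Λ` a short exact sequence, which `Ext¹(𝔻Λ, Λ) = 0` splits. Dually, `Hom(τ⁻¹Λ, Λ) = 0` gives `Λ` an
injective coresolution of length one, split by the same `Ext¹`; higher `Ext` groups play no role. A
Gorenstein projective module embeds in a projective, so if it is injective it is a summand of that
projective; the Gorenstein injective case is dual.

The conditions on all cotilting or tilting modules specialise to `𝔻Λ` and `Λ`. Conversely, when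
projectives and injectives coincide, a module of projective or injective dimension at most one is
projective and injective, as the short resolution splits. -/

namespace FDAlg

/-! ### Additive closures -/

/-- `X` lies in `add Y`, expressed through families of maps `X → Y → X` whose composites sum to the
identity of `X`. -/
def MemAdd (A X Y : Type u) [Ring A] [AddCommGroup X] [Module A X] [AddCommGroup Y]
    [Module A Y] : Prop :=
  ∃ (ι : Type u) (_ : Fintype ι) (f : ι → X →ₗ[A] Y) (g : ι → Y →ₗ[A] X),
    ∑ i, g i ∘ₗ f i = LinearMap.id

section MemAdd

variable {A : Type u} [Ring A] {X Y Z : Type u} [AddCommGroup X] [Module A X]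
  [AddCommGroup Y] [Module A Y] [AddCommGroup Z] [Module A Z]

theorem MemAdd.of_retract (f : X →ₗ[A] Y) (g : Y →ₗ[A] X) (h : g ∘ₗ f = LinearMap.id) :
    MemAdd A X Y :=
  ⟨PUnit, inferInstance, fun _ => f, fun _ => g, by simpa using h⟩

theorem MemAdd.of_equiv (e : X ≃ₗ[A] Y) : MemAdd A X Y :=
  .of_retract e.toLinearMap e.symm.toLinearMap (by ext; simp)

theorem MemAdd.sum_apply {ι : Type u} [Fintype ι] {f : ι → X →ₗ[A] Y} {g : ι → Y →ₗ[A] X}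
    (h : ∑ i, g i ∘ₗ f i = LinearMap.id) (x : X) : ∑ i, g i (f i x) = x := by
  simpa using LinearMap.congr_fun h x

theorem MemAdd.trans (h₁ : MemAdd A X Y) (h₂ : MemAdd A Y Z) : MemAdd A X Z := by
  obtain ⟨ι, _, f, g, h⟩ := h₁
  obtain ⟨κ, _, f', g', h'⟩ := h₂
  refine ⟨ι × κ, inferInstance, fun i => f' i.2 ∘ₗ f i.1, fun i => g i.1 ∘ₗ g' i.2,
    LinearMap.ext fun x => ?_⟩
  simp only [LinearMap.sum_apply, LinearMap.comp_apply, Fintype.sum_prod_type, LinearMap.id_apply]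
  conv_rhs => rw [← MemAdd.sum_apply h x]
  refine Finset.sum_congr rfl fun i _ => ?_
  rw [← map_sum, MemAdd.sum_apply h']

theorem MemAdd.congr {X' Y' : Type u} [AddCommGroup X'] [Module A X'] [AddCommGroup Y']
    [Module A Y'] (h : MemAdd A X Y) (e : X' ≃ₗ[A] X) (e' : Y ≃ₗ[A] Y') : MemAdd A X' Y' :=
  ((MemAdd.of_equiv e).trans h).trans (MemAdd.of_equiv e')

theorem MemAdd.injective (h : MemAdd A X Y) [Module.Injective A Y] : Module.Injective A X := by
  obtain ⟨ι, _, f, g, h⟩ := h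
  refine ⟨fun M N _ _ _ _ i hi p => ?_⟩
  choose q hq using fun j => Module.Injective.out i hi (f j ∘ₗ p)
  refine ⟨∑ j, g j ∘ₗ q j, fun x => ?_⟩
  simp only [LinearMap.sum_apply, LinearMap.comp_apply, hq]
  exact MemAdd.sum_apply h (p x)

theorem MemAdd.exists_retract (h : MemAdd A X Y) :
    ∃ (ι : Type u) (_ : Fintype ι) (s : X →ₗ[A] (ι → Y)) (r : (ι → Y) →ₗ[A] X),
      r ∘ₗ s = LinearMap.id := by
  classical
  obtain ⟨ι, _, f, g, h⟩ := h
  refine ⟨ι, inferInstance, LinearMap.pi f, LinearMap.lsum A (fun _ => Y) ℕ g,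
    LinearMap.ext fun x => ?_⟩
  simpa using MemAdd.sum_apply h x

theorem MemAdd.projective (h : MemAdd A X Y) [Module.Projective A Y] : Module.Projective A X := by
  obtain ⟨ι, _, s, r, h⟩ := h.exists_retract
  have : Module.Projective A (ι → Y) :=
    Module.Projective.of_equiv (DFinsupp.linearEquivFunOnFintype (R := A) (M := fun _ : ι => Y))
  exact Module.Projective.of_split s r h

theorem MemAdd.finite (h : MemAdd A X Y) [Module.Finite A Y] : Module.Finite A X := by
  obtain ⟨ι, _, s, r, h⟩ := h.exists_retract
  exact Module.Finite.of_surjective r fun x => ⟨s x, LinearMap.congr_fun h x⟩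

theorem MemAdd.pi (ι : Type u) [Finite ι] : MemAdd A (ι → Y) Y := by
  classical
  have := Fintype.ofFinite ι
  refine ⟨ι, inferInstance, fun i => LinearMap.proj i, fun i => LinearMap.single A (fun _ => Y) i,
    LinearMap.ext fun x => ?_⟩
  simpa using Finset.univ_sum_single x

/-- The additive closure is stable under retracts of finite powers. -/
theorem MemAdd.of_retract_pi {ι : Type} [Finite ι] (s : X →ₗ[A] (ι → Y)) (r : (ι → Y) →ₗ[A] X)
    (h : r ∘ₗ s = LinearMap.id) : MemAdd A X Y := by
  -- `MemAdd` is indexed by types in `u`, so the index set is lifted there.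
  let e : (ι → Y) ≃ₗ[A] (ULift.{u} ι → Y) := LinearEquiv.funCongrLeft A Y Equiv.ulift
  exact (MemAdd.of_retract (e.toLinearMap ∘ₗ s) (r ∘ₗ e.symm.toLinearMap)
    (LinearMap.ext fun x => by simpa using LinearMap.congr_fun h x)).trans (MemAdd.pi _)

theorem MemAdd.of_projective (A P : Type u) [Ring A] [AddCommGroup P] [Module A P]
    [Module.Finite A P] [Module.Projective A P] : MemAdd A P A := by
  obtain ⟨n, p, hp⟩ := Module.Finite.exists_fin' A P
  obtain ⟨s, hs⟩ := Module.projective_lifting_property p LinearMap.id hp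
  exact .of_retract_pi s p hs

/-! ### Trace ideals -/

/-- The trace of `X`: the left ideal generated by the images of all maps `X → A`. -/
def traceIdeal (A X : Type u) [Ring A] [AddCommGroup X] [Module A X] : Submodule A A :=
  ⨆ f : X →ₗ[A] A, LinearMap.range f

theorem MemAdd.traceIdeal_le (h : MemAdd A X Y) : traceIdeal A X ≤ traceIdeal A Y := by
  obtain ⟨ι, _, f, g, h⟩ := h
  refine iSup_le fun p => ?_
  rintro _ ⟨x, rfl⟩
  rw [← MemAdd.sum_apply h x, map_sum]
  exact Submodule.sum_mem _ fun i _ =>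
    le_iSup (fun q : Y →ₗ[A] A => LinearMap.range q) (p ∘ₗ g i) ⟨f i x, rfl⟩

/-- A finitely generated projective module generated by `Y` lies in `add Y`. -/
theorem MemAdd.of_iSup_range_eq_top [Module.Finite A X] [Module.Projective A X]
    (h : ⨆ g : Y →ₗ[A] X, LinearMap.range g = ⊤) : MemAdd A X Y := by
  classical
  -- By compactness finitely many maps `Y → X` already generate `X`; their sum is a surjection from
  -- a finite power of `Y`, which splits.
  have hc : IsCompactElement (⊤ : Submodule A X) :=
    (Submodule.fg_iff_compact _).1 Module.Finite.fg_top
  obtain ⟨s, hs⟩ := (CompleteLattice.isCompactElement_iff_exists_le_iSup_of_le_iSup _).1 hc _ _ h.ge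
  let p : (s → Y) →ₗ[A] X := LinearMap.lsum A (fun _ => Y) ℕ fun g => g.1
  have hp : Function.Surjective p := by
    rw [← LinearMap.range_eq_top, eq_top_iff]
    refine hs.trans (Finset.sup_le fun g hg => ?_)
    rintro _ ⟨y, rfl⟩
    refine ⟨Pi.single ⟨g, hg⟩ y, ?_⟩
    simp only [p, LinearMap.lsum_apply, LinearMap.sum_apply, LinearMap.comp_apply,
      LinearMap.proj_apply]
    rw [Finset.sum_eq_single ⟨g, hg⟩]
    · simp
    · intro b _ hb
      simp [Pi.single_eq_of_ne hb]
    · simp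
  obtain ⟨t, ht⟩ := Module.projective_lifting_property p LinearMap.id hp
  exact (MemAdd.of_retract t p ht).trans (MemAdd.pi _)

/-- The coordinates `f i x` of an element of `X` lie in the trace of `X`, hence in that of `Y`. The
maps `g i : A → X` carry the trace of `Y` into the sum of the images of maps `Y → X`, so `Y`
generates `X`. -/
theorem MemAdd.of_traceIdeal_le [Module.Finite A X] [Module.Projective A X]
    (h : traceIdeal A X ≤ traceIdeal A Y) : MemAdd A X Y := by
  refine .of_iSup_range_eq_top (top_le_iff.1 fun x _ => ?_)
  obtain ⟨ι, _, f, g, hfg⟩ := MemAdd.of_projective A X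
  rw [← MemAdd.sum_apply hfg x]
  refine Submodule.sum_mem _ fun i _ => ?_
  have hi : f i x ∈ traceIdeal A Y :=
    h (le_iSup (fun q : X →ₗ[A] A => LinearMap.range q) (f i) ⟨x, rfl⟩)
  have hle : traceIdeal A Y ≤ (⨆ q : Y →ₗ[A] X, LinearMap.range q).comap (g i) := by
    refine iSup_le fun q => ?_
    rintro _ ⟨y, rfl⟩
    exact le_iSup (fun q : Y →ₗ[A] X => LinearMap.range q) (g i ∘ₗ q) ⟨y, rfl⟩
  exact hle hi

end MemAdd

/-- Over a left artinian ring, let `N` be an operation on modules that sends `A` into `add A` and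
that preserves and reflects membership in additive closures of finitely generated projective
modules. Then `A` lies in `add (N A)`. -/
theorem memAdd_of_preserves_of_reflects (A : Type u) [Ring A] [IsArtinianRing A]
    (N : ModuleCat.{u} A → ModuleCat.{u} A)
    (preserves : ∀ X Y : ModuleCat.{u} A, MemAdd A X Y → MemAdd A (N X) (N Y))
    (reflects : ∀ X Y : ModuleCat.{u} A, MemAdd A X A → MemAdd A Y A →
      MemAdd A (N X) (N Y) → MemAdd A X Y)
    (hA : MemAdd A (N (ModuleCat.of A A)) A) :
    MemAdd A A (N (ModuleCat.of A A)) := by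
  let X : ℕ → ModuleCat.{u} A := fun k => N^[k] (ModuleCat.of A A)
  have hX : ∀ k, X (k + 1) = N (X k) := fun k => Function.iterate_succ_apply' N k _
  have step : ∀ k, MemAdd A (X (k + 1)) (X k) := by
    intro k
    induction k with
    | zero => exact hA
    | succ k ih =>
      rw [hX (k + 1), hX k]
      rw [hX k] at ih
      exact preserves _ _ ih
  have proj : ∀ k, MemAdd A (X k) A := by
    intro k
    induction k with
    | zero => exact MemAdd.of_equiv (LinearEquiv.refl A A)
    | succ k ih => exact (step k).trans ih
  -- The traces decrease with `k`; the order dual turns them into a monotone sequence.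
  let T : ℕ →o (Submodule A A)ᵒᵈ :=
    ⟨fun k => OrderDual.toDual (traceIdeal A (X k)), monotone_nat_of_le_succ fun k =>
      OrderDual.toDual_le_toDual.2 (step k).traceIdeal_le⟩
  obtain ⟨n, hn⟩ := IsArtinian.monotone_stabilizes T
  have hT : traceIdeal A (X n) = traceIdeal A (X (n + 1)) := hn (n + 1) n.le_succ
  have hfin := (proj n).finite
  have hproj := (proj n).projective
  have key : MemAdd A (X n) (X (n + 1)) := MemAdd.of_traceIdeal_le hT.le
  -- Only `key` is carried down: reflecting it along `N` lowers `n` by one until it speaks of `A`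
  -- and `N A`.
  clear hT hn hfin hproj
  induction n with
  | zero => exact key
  | succ n ih =>
    rw [hX (n + 1)] at key
    rw [hX n] at key
    refine ih (reflects _ _ (proj _) ?_ ?_)
    · exact proj (n + 1)
    · rw [hX n]
      exact key

/-! ### The duality between left and right modules -/

theorem KDual.ext {K N : Type u} [Field K] [AddCommGroup N] [Module K N] {φ ψ : KDual K N}
    (h : ∀ n, φ n = ψ n) : φ = ψ := LinearMap.ext h

section Duality

variable (K Λ : Type u) [Field K] [Ring Λ] [Algebra K Λ]

theorem isScalarTower_compHom (M : Type u) [AddCommGroup M] [Module Λ M] :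
    letI : Module K M := Module.compHom M (algebraMap K Λ)
    IsScalarTower K Λ M :=
  letI : Module K M := Module.compHom M (algebraMap K Λ)
  ⟨fun k a x => by
    change (k • a) • x = algebraMap K Λ k • a • x
    rw [Algebra.smul_def, mul_smul]⟩

instance KDual.isScalarTower_left (U : Type u) [AddCommGroup U] [Module K U] [Module Λᵐᵒᵖ U]
    [IsScalarTower K Λᵐᵒᵖ U] : IsScalarTower K Λ (KDual K U) :=
  ⟨fun k a φ => LinearMap.ext fun x => by
    change (show U →ₗ[K] K from φ) (MulOpposite.op (k • a) • x) =
      k • (show U →ₗ[K] K from φ) (MulOpposite.op a • x)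
    rw [MulOpposite.op_smul, smul_assoc, map_smul]⟩

instance KDual.isScalarTower_right (M : Type u) [AddCommGroup M] [Module K M] [Module Λ M]
    [IsScalarTower K Λ M] : IsScalarTower K Λᵐᵒᵖ (KDual K M) :=
  ⟨fun k a φ => LinearMap.ext fun x => by
    change (show M →ₗ[K] K from φ) ((k • MulOpposite.unop a) • x) =
      k • (show M →ₗ[K] K from φ) (MulOpposite.unop a • x)
    rw [smul_assoc, map_smul]⟩

variable {Λ}

/-- The dual of a map of right modules. -/
def KDual.mapLeft {U V : Type u} [AddCommGroup U] [Module K U] [Module Λᵐᵒᵖ U]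
    [IsScalarTower K Λᵐᵒᵖ U] [AddCommGroup V] [Module K V] [Module Λᵐᵒᵖ V]
    [IsScalarTower K Λᵐᵒᵖ V] (h : U →ₗ[Λᵐᵒᵖ] V) : KDual K V →ₗ[Λ] KDual K U where
  toFun φ := LinearMap.comp (show V →ₗ[K] K from φ) (h.restrictScalars K)
  map_add' _ _ := rfl
  map_smul' a φ := LinearMap.ext fun x =>
    congrArg (show V →ₗ[K] K from φ) (h.map_smul (MulOpposite.op a) x).symm

/-- The dual of a map of left modules. -/
def KDual.mapRight {M M' : Type u} [AddCommGroup M] [Module K M] [Module Λ M]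
    [IsScalarTower K Λ M] [AddCommGroup M'] [Module K M'] [Module Λ M']
    [IsScalarTower K Λ M'] (h : M →ₗ[Λ] M') : KDual K M' →ₗ[Λᵐᵒᵖ] KDual K M where
  toFun φ := LinearMap.comp (show M' →ₗ[K] K from φ) (h.restrictScalars K)
  map_add' _ _ := rfl
  map_smul' a φ := LinearMap.ext fun x =>
    congrArg (show M' →ₗ[K] K from φ) (h.map_smul (MulOpposite.unop a) x).symm

theorem KDual.mapLeft_apply {U V : Type u} [AddCommGroup U] [Module K U] [Module Λᵐᵒᵖ U]
    [IsScalarTower K Λᵐᵒᵖ U] [AddCommGroup V] [Module K V] [Module Λᵐᵒᵖ V]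
    [IsScalarTower K Λᵐᵒᵖ V] (h : U →ₗ[Λᵐᵒᵖ] V) (φ : KDual K V) (x : U) :
    KDual.mapLeft K h φ x = φ (h x) := rfl

theorem KDual.mapRight_apply {M M' : Type u} [AddCommGroup M] [Module K M] [Module Λ M]
    [IsScalarTower K Λ M] [AddCommGroup M'] [Module K M'] [Module Λ M']
    [IsScalarTower K Λ M'] (h : M →ₗ[Λ] M') (φ : KDual K M') (x : M) :
    KDual.mapRight K h φ x = φ (h x) := rfl

theorem KDual.sum_apply {N : Type u} [AddCommGroup N] [Module K N] {ι : Type u} (s : Finset ι)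
    (φ : ι → KDual K N) (x : N) : (∑ i ∈ s, φ i) x = ∑ i ∈ s, φ i x :=
  LinearMap.sum_apply s (fun i => (show N →ₗ[K] K from φ i)) x

theorem KDual.map_sum {N : Type u} [AddCommGroup N] [Module K N] {ι : Type u} (s : Finset ι)
    (φ : KDual K N) (x : ι → N) : φ (∑ i ∈ s, x i) = ∑ i ∈ s, φ (x i) :=
  _root_.map_sum (show N →ₗ[K] K from φ) x s

theorem MemAdd.kDual_left {U V : Type u} [AddCommGroup U] [Module K U] [Module Λᵐᵒᵖ U]
    [IsScalarTower K Λᵐᵒᵖ U] [AddCommGroup V] [Module K V] [Module Λᵐᵒᵖ V]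
    [IsScalarTower K Λᵐᵒᵖ V] (h : MemAdd Λᵐᵒᵖ U V) : MemAdd Λ (KDual K U) (KDual K V) := by
  obtain ⟨ι, _, f, g, h⟩ := h
  refine ⟨ι, inferInstance, fun i => KDual.mapLeft K (g i), fun i => KDual.mapLeft K (f i),
    LinearMap.ext fun φ => KDual.ext fun x => ?_⟩
  simp only [LinearMap.sum_apply, LinearMap.comp_apply, KDual.sum_apply, KDual.mapLeft_apply,
    LinearMap.id_apply]
  rw [← KDual.map_sum, MemAdd.sum_apply h]

theorem MemAdd.kDual_right {M M' : Type u} [AddCommGroup M] [Module K M] [Module Λ M]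
    [IsScalarTower K Λ M] [AddCommGroup M'] [Module K M'] [Module Λ M']
    [IsScalarTower K Λ M'] (h : MemAdd Λ M M') : MemAdd Λᵐᵒᵖ (KDual K M) (KDual K M') := by
  obtain ⟨ι, _, f, g, h⟩ := h
  refine ⟨ι, inferInstance, fun i => KDual.mapRight K (g i), fun i => KDual.mapRight K (f i),
    LinearMap.ext fun φ => KDual.ext fun x => ?_⟩
  simp only [LinearMap.sum_apply, LinearMap.comp_apply, KDual.sum_apply, KDual.mapRight_apply,
    LinearMap.id_apply]
  rw [← KDual.map_sum, MemAdd.sum_apply h]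

/-- Finite-dimensional right modules are reflexive. -/
noncomputable def KDual.evalRight (U : Type u) [AddCommGroup U] [Module K U] [Module Λᵐᵒᵖ U]
    [IsScalarTower K Λᵐᵒᵖ U] [Module.Finite K U] :
    U ≃ₗ[Λᵐᵒᵖ] KDual K (KDual K U) :=
  { (Module.evalEquiv K U).toAddEquiv with
    map_smul' := fun _ _ => rfl }

/-- Finite-dimensional left modules are reflexive. -/
noncomputable def KDual.evalLeft (M : Type u) [AddCommGroup M] [Module K M] [Module Λ M]
    [IsScalarTower K Λ M] [Module.Finite K M] :
    M ≃ₗ[Λ] KDual K (KDual K M) :=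
  { (Module.evalEquiv K M).toAddEquiv with
    map_smul' := fun _ _ => rfl }

theorem KDual.eq_zero_of_forall {N : Type u} [AddCommGroup N] [Module K N] (x : N)
    (h : ∀ φ : KDual K N, φ x = 0) : x = 0 :=
  (Module.forall_dual_apply_eq_zero_iff K x).1 h

variable (Λ)

/-- `𝔻Λ` is an injective left module. -/
instance DReg.injective : Module.Injective Λ (DReg K Λ) := by
  refine ⟨fun X Y _ _ _ _ f hf g => ?_⟩
  let : Module K X := Module.compHom X (algebraMap K Λ)
  let : Module K Y := Module.compHom Y (algebraMap K Λ)
  have : IsScalarTower K Λ X := isScalarTower_compHom K Λ X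
  have : IsScalarTower K Λ Y := isScalarTower_compHom K Λ Y
  -- Evaluation at `1` identifies `Hom_Λ(X, 𝔻Λ)` with the `K`-dual of `X`, so extending `g` amounts
  -- to extending a functional of vector spaces.
  let g₁ : X →ₗ[K] K :=
    { toFun := fun x => g x 1
      map_add' := fun x y => by rw [map_add]; rfl
      map_smul' := fun k x => by
        change g (algebraMap K Λ k • x) 1 = k • g x 1
        rw [map_smul, KDual.left_smul_apply]
        change (show Λ →ₗ[K] K from g x) (1 * algebraMap K Λ k) =
          k • (show Λ →ₗ[K] K from g x) 1
        rw [one_mul, Algebra.algebraMap_eq_smul_one, map_smul] }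
  obtain ⟨r, hr⟩ := LinearMap.exists_leftInverse_of_injective (f.restrictScalars K)
    (LinearMap.ker_eq_bot.2 hf)
  let h₁ : Y →ₗ[K] K := g₁ ∘ₗ r
  refine ⟨{ toFun := fun y => show Λ →ₗ[K] K from
              h₁ ∘ₗ (LinearMap.toSpanSingleton Λ Y y).restrictScalars K
            map_add' := fun y z => LinearMap.ext fun a => ?_
            map_smul' := fun b y => LinearMap.ext fun a => ?_ }, fun x => KDual.ext fun a => ?_⟩
  · change h₁ (a • (y + z)) = h₁ (a • y) + h₁ (a • z)
    rw [smul_add, map_add]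
  · change h₁ (a • b • y) = h₁ ((a * b) • y)
    rw [mul_smul]
  · change g₁ (r (a • f x)) = g x a
    have := LinearMap.congr_fun hr (a • x)
    simp only [LinearMap.comp_apply, LinearMap.restrictScalars_apply, map_smul,
      LinearMap.id_apply] at this
    rw [this]
    change g (a • x) 1 = g x a
    rw [map_smul, KDual.left_smul_apply]
    change g x (1 * a) = g x a
    rw [one_mul]

variable {Λ}

/-! ### Duality of projective modules -/

theorem MemAdd.hom {A B R X Y : Type u} [Ring A] [Ring B] [AddCommGroup R] [Module A R]
    [Module B R] [SMulCommClass A B R] [AddCommGroup X] [Module A X] [AddCommGroup Y] [Module A Y]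
    (h : MemAdd A X Y) : MemAdd B (X →ₗ[A] R) (Y →ₗ[A] R) := by
  obtain ⟨ι, _, f, g, h⟩ := h
  refine ⟨ι, inferInstance, fun i => LinearMap.lcomp B R (g i), fun i => LinearMap.lcomp B R (f i),
    LinearMap.ext fun φ => LinearMap.ext fun x => ?_⟩
  simp only [LinearMap.sum_apply, LinearMap.comp_apply, LinearMap.lcomp_apply,
    LinearMap.id_apply]
  rw [← map_sum, MemAdd.sum_apply h]

/-- The dual of the regular module is the regular module on the other side. -/
def homRegularEquiv (Λ : Type u) [Ring Λ] : (Λ →ₗ[Λ] Λ) ≃ₗ[Λᵐᵒᵖ] Λ where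
  toFun f := f 1
  invFun a := LinearMap.toSpanSingleton Λ Λ a
  map_add' _ _ := rfl
  map_smul' _ _ := rfl
  left_inv f := by ext; simp
  right_inv a := by simp

/-- Evaluation `X → X**`. -/
def homEval (Λ X : Type u) [Ring Λ] [AddCommGroup X] [Module Λ X] :
    X →ₗ[Λ] ((X →ₗ[Λ] Λ) →ₗ[Λᵐᵒᵖ] Λ) where
  toFun x :=
    { toFun := fun α => α x
      map_add' := fun _ _ => rfl
      map_smul' := fun _ _ => rfl }
  map_add' x y := LinearMap.ext fun α => α.map_add x y
  map_smul' a x := LinearMap.ext fun α => α.map_smul a x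

/-- The maps `f i` and the elements `g i 1` form a dual basis of `X`, from which injectivity and an
explicit preimage are read off. -/
theorem homEval_bijective {X : Type u} [AddCommGroup X] [Module Λ X] (h : MemAdd Λ X Λ) :
    Function.Bijective (homEval Λ X) := by
  obtain ⟨ι, _, f, g, h⟩ := h
  have hx : ∀ x, ∑ i, f i x • g i 1 = x := fun x => by
    conv_rhs => rw [← MemAdd.sum_apply h x]
    exact Finset.sum_congr rfl fun i _ => by rw [← map_smul, smul_eq_mul, mul_one]
  constructor
  · rw [injective_iff_map_eq_zero]
    intro x h0
    rw [← hx x]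
    refine Finset.sum_eq_zero fun i _ => ?_
    have : f i x = 0 := LinearMap.congr_fun h0 (f i)
    rw [this, zero_smul]
  · intro θ
    refine ⟨∑ i, θ (f i) • g i 1, LinearMap.ext fun α => ?_⟩
    change α (∑ i, θ (f i) • g i 1) = θ α
    have hα : α = ∑ i, MulOpposite.op (α (g i 1)) • f i := LinearMap.ext fun x => by
      conv_lhs => rw [← hx x]
      simp [LinearMap.sum_apply]
    conv_rhs => rw [hα]
    simp

/-- The bidual of a finitely generated projective module. -/
noncomputable def homBidualEquiv {X : Type u} [AddCommGroup X] [Module Λ X] (h : MemAdd Λ X Λ) :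
    X ≃ₗ[Λ] ((X →ₗ[Λ] Λ) →ₗ[Λᵐᵒᵖ] Λ) :=
  LinearEquiv.ofBijective _ (homEval_bijective h)

variable (Λ) [Module.Finite K Λ]

/-- Supplies the finite dimensionality under which `𝔻` can be undone by reflexivity. -/
theorem finite_hom {X : Type u} [AddCommGroup X] [Module Λ X] (h : MemAdd Λ X Λ) :
    Module.Finite K (X →ₗ[Λ] Λ) := by
  have : Module.Finite Λᵐᵒᵖ (X →ₗ[Λ] Λ) :=
    ((h.hom (B := Λᵐᵒᵖ) (R := Λ)).trans (MemAdd.of_equiv ((homRegularEquiv Λ).trans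
      (MulOpposite.opLinearEquiv Λᵐᵒᵖ)))).finite
  have : Module.Finite K Λᵐᵒᵖ := Module.Finite.equiv (MulOpposite.opLinearEquiv K)
  exact Module.Finite.trans Λᵐᵒᵖ _

/-- If `𝔻Λ` is projective, then `Λ` lies in `add 𝔻Λ`. -/
theorem regular_memAdd_dReg (h : MemAdd Λ (DReg K Λ) Λ) : MemAdd Λ Λ (DReg K Λ) := by
  have : IsArtinianRing Λ := IsArtinianRing.of_finite K Λ
  have e : MemAdd Λ (KDual K (Λ →ₗ[Λ] Λ)) (DReg K Λ) :=
    (MemAdd.of_equiv (homRegularEquiv Λ)).kDual_left K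
  refine (memAdd_of_preserves_of_reflects Λ
    (fun X => ModuleCat.of Λ (KDual K (X →ₗ[Λ] Λ)))
    (fun X Y hXY => hXY.hom.kDual_left K) (fun X Y hX hY hXY => ?_) (e.trans h)).trans e
  -- The Nakayama functor reflects `add` on projectives: reflexivity undoes `𝔻`, and the bidual
  -- isomorphism undoes `Hom(-, Λ)`.
  have := finite_hom K Λ hX
  have := finite_hom K Λ hY
  have h₁ : MemAdd Λᵐᵒᵖ (X →ₗ[Λ] Λ) (Y →ₗ[Λ] Λ) :=
    (hXY.kDual_right K).congr (KDual.evalRight K _) (KDual.evalRight K _).symm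
  have h₂ := h₁.hom (B := Λ) (R := Λ)
  exact h₂.congr (homBidualEquiv hX) (homBidualEquiv hY).symm

/-- If `Λ` is a summand of a power of `𝔻Λ`, then `𝔻Λ` is projective. -/
theorem dReg_memAdd_regular (h : MemAdd Λ Λ (DReg K Λ)) : MemAdd Λ (DReg K Λ) Λ := by
  have : Module.Finite K Λᵐᵒᵖ := Module.Finite.equiv (MulOpposite.opLinearEquiv K)
  -- Dualising the hypothesis makes the right module `𝔻Λ` projective, so the previous result applies
  -- to `Λᵐᵒᵖ`; dualising its conclusion returns to left modules.
  let e : DReg K Λᵐᵒᵖ ≃ₗ[Λᵐᵒᵖ] KDual K Λ :=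
    { toFun := fun φ => LinearMap.comp (show Λᵐᵒᵖ →ₗ[K] K from φ)
        (MulOpposite.opLinearEquiv K).toLinearMap
      invFun := fun φ => LinearMap.comp (show Λ →ₗ[K] K from φ)
        (MulOpposite.opLinearEquiv K).symm.toLinearMap
      map_add' := fun _ _ => rfl
      map_smul' := fun _ _ => rfl
      left_inv := fun _ => rfl
      right_inv := fun _ => rfl }
  have h₁ : MemAdd Λᵐᵒᵖ (KDual K Λ) Λ :=
    (h.kDual_right K).trans (MemAdd.of_equiv (KDual.evalRight K Λ).symm)
  have h₂ := regular_memAdd_dReg K Λᵐᵒᵖ (h₁.congr e (MulOpposite.opLinearEquiv Λᵐᵒᵖ))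
  have h₃ : MemAdd Λᵐᵒᵖ Λ (KDual K Λ) := h₂.congr (MulOpposite.opLinearEquiv Λᵐᵒᵖ) e
  exact (h₃.kDual_left K).trans (MemAdd.of_equiv (KDual.evalLeft K Λ).symm)

end Duality

/-! ### Extending and lifting maps along short exact sequences -/

section Extensions

variable {Λ : Type u} [Ring Λ] {M N A B : Type u} [AddCommGroup M] [Module Λ M]
  [AddCommGroup N] [Module Λ N] [AddCommGroup A] [Module Λ A] [AddCommGroup B] [Module Λ B]

theorem shortExact_of {f : A →ₗ[Λ] B} {g : B →ₗ[Λ] M} (hf : Function.Injective f)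
    (hfg : Function.Exact f g) (hg : Function.Surjective g) :
    (ShortComplex.mk (ModuleCat.ofHom f) (ModuleCat.ofHom g)
      (by rw [← ModuleCat.ofHom_comp, hfg.linearMap_comp_eq_zero]; rfl)).ShortExact :=
  ModuleCat.shortComplex_shortExact _ hfg hf hg

/-- The obstruction to extending `p` is its image under the connecting map into `Ext¹(M, N)`. -/
theorem ExtVanishes.exists_extension (h : ExtVanishes Λ M N 1) {f : A →ₗ[Λ] B} {g : B →ₗ[Λ] M}
    (hf : Function.Injective f) (hfg : Function.Exact f g) (hg : Function.Surjective g)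
    (p : A →ₗ[Λ] N) : ∃ q : B →ₗ[Λ] N, q ∘ₗ f = p := by
  have hS := shortExact_of hf hfg hg
  have : Subsingleton (Abelian.Ext.{u} (ModuleCat.of Λ M) (ModuleCat.of Λ N) 1) := h
  obtain ⟨x, hx⟩ := Abelian.Ext.contravariant_sequence_exact₁ hS (ModuleCat.of Λ N)
    (Abelian.Ext.mk₀ (ModuleCat.ofHom p)) (add_zero 1) (Subsingleton.elim _ _)
  obtain ⟨q, rfl⟩ := (Abelian.Ext.mk₀_bijective _ _).2 x
  rw [Abelian.Ext.mk₀_comp_mk₀] at hx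
  exact ⟨q.hom, congrArg ModuleCat.Hom.hom ((Abelian.Ext.mk₀_bijective _ _).1 hx)⟩

theorem ExtVanishes.exists_lift (h : ExtVanishes Λ N A 1) {f : A →ₗ[Λ] B} {g : B →ₗ[Λ] M}
    (hf : Function.Injective f) (hfg : Function.Exact f g) (hg : Function.Surjective g)
    (p : N →ₗ[Λ] M) : ∃ q : N →ₗ[Λ] B, g ∘ₗ q = p := by
  have hS := shortExact_of hf hfg hg
  have : Subsingleton (Abelian.Ext.{u} (ModuleCat.of Λ N) (ModuleCat.of Λ A) 1) := h
  obtain ⟨x, hx⟩ := Abelian.Ext.covariant_sequence_exact₃ (ModuleCat.of Λ N) hS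
    (Abelian.Ext.mk₀ (ModuleCat.ofHom p)) (zero_add 1) (Subsingleton.elim _ _)
  obtain ⟨q, rfl⟩ := (Abelian.Ext.mk₀_bijective _ _).2 x
  rw [Abelian.Ext.mk₀_comp_mk₀] at hx
  exact ⟨q.hom, congrArg ModuleCat.Hom.hom ((Abelian.Ext.mk₀_bijective _ _).1 hx)⟩

theorem extVanishes_of_projective [Module.Projective Λ M] {i : ℕ} (hi : 1 ≤ i) :
    ExtVanishes Λ M N i := by
  have : Projective (ModuleCat.of Λ M) := (IsProjective.iff_projective M).1 inferInstance
  exact HasProjectiveDimensionLT.subsingleton (ModuleCat.of Λ M) 1 i hi _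

theorem extVanishes_of_injective [Module.Injective Λ N] {i : ℕ} (hi : 1 ≤ i) :
    ExtVanishes Λ M N i := by
  have : Injective (ModuleCat.of Λ N) :=
    (Module.injective_iff_injective_object Λ N).1 inferInstance
  exact HasInjectiveDimensionLT.subsingleton (ModuleCat.of Λ N) 1 i hi _

/-- The kernel of a surjection from a projective module onto a module of projective dimension at
most one is projective. -/
theorem projective_of_projDim_le_one (h : HasProjectiveDimensionLE (ModuleCat.of Λ M) 1)
    {f : A →ₗ[Λ] B} {g : B →ₗ[Λ] M} (hf : Function.Injective f) (hfg : Function.Exact f g)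
    (hg : Function.Surjective g) [Module.Projective Λ B] : Module.Projective Λ A := by
  have hB : Projective (ModuleCat.of Λ B) := (IsProjective.iff_projective B).1 inferInstance
  exact (IsProjective.iff_projective A).2 (projective_iff_hasProjectiveDimensionLT_one.2
    (((shortExact_of hf hfg hg).hasProjectiveDimensionLT_X₃_iff 0 hB).1 h))

/-- The cokernel of an embedding of a module of injective dimension at most one into an injective
module is injective. -/
theorem injective_of_injDim_le_one (h : HasInjectiveDimensionLE (ModuleCat.of Λ A) 1)
    {f : A →ₗ[Λ] B} {g : B →ₗ[Λ] M} (hf : Function.Injective f) (hfg : Function.Exact f g)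
    (hg : Function.Surjective g) [Module.Injective Λ B] : Module.Injective Λ M := by
  have hB : Injective (ModuleCat.of Λ B) :=
    (Module.injective_iff_injective_object Λ B).1 inferInstance
  exact (Module.injective_iff_injective_object Λ M).2
    (injective_iff_hasInjectiveDimensionLT_one.2
    (((shortExact_of hf hfg hg).hasInjectiveDimensionLT_X₃_iff 0 hB).2 h))

/-- If the right-hand map of a short exact sequence splits, so does the left-hand one. -/
theorem exists_retraction_of_section {f : A →ₗ[Λ] B} {g : B →ₗ[Λ] M}
    (hf : Function.Injective f) (hfg : Function.Exact f g) {s : M →ₗ[Λ] B}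
    (hs : g ∘ₗ s = LinearMap.id) : ∃ r : B →ₗ[Λ] A, r ∘ₗ f = LinearMap.id :=
  (((Function.Exact.split_tfae' hfg).out 0 1 :
    (Function.Injective f ∧ ∃ l, g ∘ₗ l = LinearMap.id) ↔
      (Function.Surjective g ∧ ∃ l, l ∘ₗ f = LinearMap.id)).1 ⟨hf, s, hs⟩).2

theorem exists_section_of_retraction {f : A →ₗ[Λ] B} {g : B →ₗ[Λ] M}
    (hg : Function.Surjective g) (hfg : Function.Exact f g) {r : B →ₗ[Λ] A}
    (hr : r ∘ₗ f = LinearMap.id) : ∃ s : M →ₗ[Λ] B, g ∘ₗ s = LinearMap.id :=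
  (((Function.Exact.split_tfae' hfg).out 0 1 :
    (Function.Injective f ∧ ∃ l, g ∘ₗ l = LinearMap.id) ↔
      (Function.Surjective g ∧ ∃ l, l ∘ₗ f = LinearMap.id)).2 ⟨hg, r, hr⟩).2

theorem exists_retraction_of_injective {f : A →ₗ[Λ] B} (hf : Function.Injective f)
    [Module.Injective Λ A] : ∃ r : B →ₗ[Λ] A, r ∘ₗ f = LinearMap.id := by
  obtain ⟨r, hr⟩ := Module.Injective.out f hf (LinearMap.id : A →ₗ[Λ] A)
  exact ⟨r, LinearMap.ext hr⟩

end Extensions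

/-! ### Injective modules and `add 𝔻Λ` -/

theorem isTilting_regular (Λ : Type u) [Ring Λ] : IsTilting Λ Λ where
  finite := inferInstance
  projDim_le_one := by
    have : Projective (ModuleCat.of Λ Λ) := (IsProjective.iff_projective Λ).1 inferInstance
    exact inferInstance
  ext_one := extVanishes_of_projective le_rfl
  exists_coresolution := by
    refine ⟨ModuleCat.of Λ Λ, ModuleCat.of Λ PUnit, LinearMap.id, 0,
      ⟨1, LinearMap.pi fun _ => LinearMap.id, LinearMap.proj 0, rfl⟩,
      ⟨0, 0, 0, LinearMap.ext fun _ => rfl⟩, fun _ _ h => h, fun x => ?_, fun x => ⟨0, rfl⟩⟩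
    exact ⟨fun _ => ⟨x, rfl⟩, fun _ => rfl⟩

section Cogenerator

variable (K Λ : Type u) [Field K] [Ring Λ] [Algebra K Λ]

variable [Module.Finite K Λ]

/-- A functional `φ` on `M` induces the `Λ`-linear map `m ↦ (a ↦ φ (a m))`. The coordinate
functionals of a `K`-basis separate points, as seen at `a = 1`. -/
theorem exists_embedding_dReg (M : Type u) [AddCommGroup M] [Module Λ M] [Module.Finite Λ M] :
    ∃ (n : ℕ) (f : M →ₗ[Λ] (Fin n → DReg K Λ)), Function.Injective f := by
  let : Module K M := Module.compHom M (algebraMap K Λ)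
  have : IsScalarTower K Λ M := isScalarTower_compHom K Λ M
  have : Module.Finite K M := Module.Finite.trans Λ M
  let b := Module.finBasis K M
  let f (i : Fin (Module.finrank K M)) : M →ₗ[Λ] DReg K Λ :=
    { toFun := fun m => show Λ →ₗ[K] K from
        b.coord i ∘ₗ (LinearMap.toSpanSingleton Λ M m).restrictScalars K
      map_add' := fun y z => LinearMap.ext fun a => by
        change b.coord i (a • (y + z)) = b.coord i (a • y) + b.coord i (a • z)
        rw [smul_add, map_add]
      map_smul' := fun c y => LinearMap.ext fun a => by
        change b.coord i (a • c • y) = b.coord i ((a * c) • y)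
        rw [mul_smul] }
  refine ⟨_, LinearMap.pi f, (injective_iff_map_eq_zero _).2 fun m hm => ?_⟩
  refine b.ext_elem fun i => ?_
  have h : b.coord i ((1 : Λ) • m) = 0 :=
    congrArg (fun φ : Fin (Module.finrank K M) → DReg K Λ => φ i 1) hm
  rw [one_smul] at h
  simpa using h

theorem MemAdd.of_injective (M : Type u) [AddCommGroup M] [Module Λ M] [Module.Finite Λ M]
    [Module.Injective Λ M] : MemAdd Λ M (DReg K Λ) := by
  obtain ⟨n, f, hf⟩ := exists_embedding_dReg K Λ M
  obtain ⟨r, hr⟩ := exists_retraction_of_injective hf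
  exact .of_retract_pi f r hr

theorem injective_regular_of_projective_dReg [Module.Projective Λ (DReg K Λ)] :
    Module.Injective Λ Λ :=
  (regular_memAdd_dReg K Λ (MemAdd.of_projective Λ (DReg K Λ))).injective

theorem projective_dReg_of_injective_regular [Module.Injective Λ Λ] :
    Module.Projective Λ (DReg K Λ) :=
  (dReg_memAdd_regular K Λ (MemAdd.of_injective K Λ Λ)).projective

theorem isCotilting_dReg : IsCotilting Λ K (DReg K Λ) where
  finite := inferInstance
  injDim_le_one := by
    have : Injective (ModuleCat.of Λ (DReg K Λ)) :=
      (Module.injective_iff_injective_object Λ _).1 inferInstance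
    exact inferInstance
  ext_one := extVanishes_of_injective le_rfl
  exists_resolution := by
    refine ⟨ModuleCat.of Λ PUnit, ModuleCat.of Λ (DReg K Λ), 0, LinearMap.id,
      ⟨1, LinearMap.pi fun _ => LinearMap.id, LinearMap.proj 0, rfl⟩,
      ⟨0, 0, 0, LinearMap.ext fun _ => rfl⟩, fun _ _ _ => rfl, fun x => ?_, fun x => ⟨x, rfl⟩⟩
    exact ⟨fun h => ⟨0, h.symm⟩, fun ⟨_, h⟩ => h.symm⟩

variable {Λ} in
/-- Over a self-injective algebra, cotilting modules are projective and injective. -/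
theorem IsCotilting.memAdd_dReg [Module.Injective Λ Λ] {T : Type u} [AddCommGroup T] [Module Λ T]
    (hT : IsCotilting Λ K T) : MemAdd Λ T (DReg K Λ) := by
  have := hT.finite
  have := projective_dReg_of_injective_regular K Λ
  obtain ⟨n, f, hf⟩ := exists_embedding_dReg K Λ T
  have hpi : MemAdd Λ (Fin n → DReg K Λ) (DReg K Λ) := .of_retract_pi LinearMap.id LinearMap.id rfl
  have := hpi.injective
  have hq := Submodule.mkQ_surjective (LinearMap.range f)
  -- The cokernel is injective, hence in `add 𝔻Λ`, hence projective; so the sequence splits.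
  have := injective_of_injDim_le_one hT.injDim_le_one hf f.exact_map_mkQ_range hq
  have := (MemAdd.of_injective K Λ ((Fin n → DReg K Λ) ⧸ LinearMap.range f)).projective
  obtain ⟨s, hs⟩ := Module.projective_lifting_property _ LinearMap.id hq
  obtain ⟨r, hr⟩ := exists_retraction_of_section hf f.exact_map_mkQ_range hs
  exact .of_retract_pi f r hr

end Cogenerator

/-- Over a self-injective algebra, tilting modules are projective and injective. -/
theorem IsTilting.memAdd_regular (K : Type u) {Λ : Type u} [Field K] [Ring Λ] [Algebra K Λ]
    [Module.Finite K Λ] [Module.Injective Λ Λ] {T : Type u} [AddCommGroup T] [Module Λ T]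
    (hT : IsTilting Λ T) : MemAdd Λ T Λ := by
  have := hT.finite
  have : IsArtinianRing Λ := IsArtinianRing.of_finite K Λ
  obtain ⟨n, p, hp⟩ := Module.Finite.exists_fin' Λ T
  have hex := LinearMap.exact_subtype_ker_map p
  have := projective_of_projDim_le_one hT.projDim_le_one (Submodule.injective_subtype _) hex hp
  -- The kernel is projective and, `Λ` being artinian, finitely generated; it is thus injective and
  -- splits off.
  have := (MemAdd.of_projective Λ (LinearMap.ker p)).injective
  obtain ⟨r, hr⟩ := exists_retraction_of_injective (Submodule.injective_subtype (LinearMap.ker p))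
  obtain ⟨s, hs⟩ := exists_section_of_retraction hp hex hr
  exact .of_retract_pi s p hs

/-! ### Gorenstein projective and Gorenstein injective modules -/

section Gorenstein

variable {Λ : Type u} [Ring Λ]

/-- The differential `(x, y) ↦ (y, 0)` of the periodic contractible complex on `T × T`. -/
def contractibleD (Λ T : Type u) [Ring Λ] [AddCommGroup T] [Module Λ T] : T × T →ₗ[Λ] T × T :=
  LinearMap.inl Λ T T ∘ₗ LinearMap.snd Λ T T

theorem exact_contractibleD (T : Type u) [AddCommGroup T] [Module Λ T] :
    Function.Exact (contractibleD Λ T) (contractibleD Λ T) := by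
  rintro ⟨x, y⟩
  constructor
  · intro h
    have hy : y = 0 := congrArg Prod.fst h
    exact ⟨(0, x), by rw [hy]; rfl⟩
  · rintro ⟨z, hz⟩
    have hy : (0 : T) = y := congrArg Prod.snd hz
    change (y, (0 : T)) = 0
    rw [← hy]
    rfl

/-- The image of the contractible differential on `T × T` is `T`. -/
noncomputable def equivRangeContractibleD (Λ T : Type u) [Ring Λ] [AddCommGroup T] [Module Λ T] :
    T ≃ₗ[Λ] LinearMap.range (contractibleD Λ T) :=
  (LinearEquiv.ofInjective (LinearMap.inl Λ T T) LinearMap.inl_injective).trans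
    (LinearEquiv.ofEq _ _ (LinearMap.range_comp_of_range_eq_top _
      (LinearMap.range_eq_top.2 LinearMap.snd_surjective)).symm)

theorem isGorensteinProjective_of_projective (T : Type u) [AddCommGroup T] [Module Λ T]
    [Module.Finite Λ T] [Module.Projective Λ T] : IsGorensteinProjective Λ T := by
  refine ⟨fun _ => ModuleCat.of Λ (T × T), fun _ => contractibleD Λ T,
    fun _ => ⟨inferInstanceAs (Module.Finite Λ (T × T)),
      inferInstanceAs (Module.Projective Λ (T × T))⟩, fun _ => exact_contractibleD T,
    fun _ φ => ⟨fun h => ?_, ?_⟩, ⟨equivRangeContractibleD Λ T⟩⟩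
  · change T × T →ₗ[Λ] Λ at φ
    -- The preimage comes from the contracting homotopy `(x, y) ↦ (0, x)`.
    refine ⟨φ ∘ₗ LinearMap.inr Λ T T ∘ₗ LinearMap.fst Λ T T, LinearMap.ext fun x => ?_⟩
    obtain ⟨x, y⟩ := x
    have hx : φ (x, 0) = 0 := LinearMap.congr_fun h ((0 : T), x)
    change φ (0, y) = φ (x, y)
    rw [← zero_add (φ (0, y)), ← hx, ← map_add]
    simp
  · rintro ⟨ψ, rfl⟩
    exact LinearMap.ext fun x => ψ.map_zero

theorem isGorensteinInjective_of_injective (K : Type u) [Field K] [Algebra K Λ] (T : Type u)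
    [AddCommGroup T] [Module Λ T] [Module.Finite Λ T] [Module.Injective Λ T] :
    IsGorensteinInjective Λ K T := by
  have hinj : Module.Injective Λ (T × T) := by
    refine ⟨fun X Y _ _ _ _ f hf g => ?_⟩
    obtain ⟨p, hp⟩ := Module.Injective.out f hf (LinearMap.fst Λ T T ∘ₗ g)
    obtain ⟨q, hq⟩ := Module.Injective.out f hf (LinearMap.snd Λ T T ∘ₗ g)
    exact ⟨p.prod q, fun x => Prod.ext (hp x) (hq x)⟩
  refine ⟨fun _ => ModuleCat.of Λ (T × T), fun _ => contractibleD Λ T,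
    fun _ => ⟨inferInstanceAs (Module.Finite Λ (T × T)), hinj⟩, fun _ => exact_contractibleD T,
    fun _ φ => ⟨fun h => ?_, ?_⟩, ⟨equivRangeContractibleD Λ T⟩⟩
  · change DReg K Λ →ₗ[Λ] T × T at φ
    refine ⟨LinearMap.inr Λ T T ∘ₗ LinearMap.fst Λ T T ∘ₗ φ, LinearMap.ext fun x => ?_⟩
    have hx : (φ x).2 = 0 := congrArg Prod.fst (LinearMap.congr_fun h x)
    exact Prod.ext rfl hx.symm
  · rintro ⟨ψ, rfl⟩
    rfl

/-- An injective Gorenstein projective module is projective. -/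
theorem IsGorensteinProjective.projective {M : Type u} [AddCommGroup M] [Module Λ M]
    [Module.Injective Λ M] (h : IsGorensteinProjective Λ M) : Module.Projective Λ M := by
  obtain ⟨P, d, hP, -, -, ⟨e⟩⟩ := h
  let f : M →ₗ[Λ] P (-1 + 1) := (LinearMap.range (d (-1))).subtype ∘ₗ e.toLinearMap
  have hf : Function.Injective f := (Submodule.injective_subtype _).comp e.injective
  obtain ⟨r, hr⟩ := exists_retraction_of_injective hf
  have := (hP (-1 + 1)).2
  exact Module.Projective.of_split f r hr

/-- A projective Gorenstein injective module is injective. -/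
theorem IsGorensteinInjective.injective {K : Type u} [Field K] [Algebra K Λ] {M : Type u}
    [AddCommGroup M] [Module Λ M] [Module.Projective Λ M] (h : IsGorensteinInjective Λ K M) :
    Module.Injective Λ M := by
  obtain ⟨I, d, hI, -, -, ⟨e⟩⟩ := h
  let f : I (-1) →ₗ[Λ] M := e.symm.toLinearMap ∘ₗ (d (-1)).rangeRestrict
  have hf : Function.Surjective f := e.symm.surjective.comp (d (-1)).surjective_rangeRestrict
  obtain ⟨s, hs⟩ := Module.projective_lifting_property f LinearMap.id hf
  have := (hI (-1)).2
  exact (MemAdd.of_retract s f hs).injective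

end Gorenstein

/-! ### Auslander-Reiten translations -/

theorem KDual.exact_mapLeft {K Λ : Type u} [Field K] [Ring Λ] [Algebra K Λ]
    {U V W : Type u} [AddCommGroup U] [Module K U] [Module Λᵐᵒᵖ U]
    [IsScalarTower K Λᵐᵒᵖ U] [AddCommGroup V] [Module K V] [Module Λᵐᵒᵖ V]
    [IsScalarTower K Λᵐᵒᵖ V] [AddCommGroup W] [Module K W] [Module Λᵐᵒᵖ W]
    [IsScalarTower K Λᵐᵒᵖ W] {f : U →ₗ[Λᵐᵒᵖ] V} {g : V →ₗ[Λᵐᵒᵖ] W} (h : Function.Exact f g) :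
    Function.Exact (KDual.mapLeft K g) (KDual.mapLeft K f) := by
  have h' : Function.Exact (f.restrictScalars K) (g.restrictScalars K) := h
  have h'' : Function.Exact (g.restrictScalars K).dualMap (f.restrictScalars K).dualMap := by
    rw [LinearMap.exact_iff, LinearMap.ker_dualMap_eq_dualAnnihilator_range,
      LinearMap.range_dualMap_eq_dualAnnihilator_ker, h'.linearMap_ker_eq]
  exact h''

section Translations

theorem MemAdd.eq_zero_of_forall {A X Y : Type u} [Ring A] [AddCommGroup X] [Module A X]
    [AddCommGroup Y] [Module A Y] (h : MemAdd A X Y) {x : X} (hx : ∀ α : X →ₗ[A] Y, α x = 0) :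
    x = 0 := by
  obtain ⟨ι, _, f, g, h⟩ := h
  rw [← MemAdd.sum_apply h x]
  exact Finset.sum_eq_zero fun i _ => by rw [hx, map_zero]

/-- The first syzygy in a minimal presentation of a projective module is zero. -/
theorem MinProjPres.subsingleton {A M : Type u} [Ring A] [AddCommGroup M] [Module A M]
    [Module.Projective A M] (p : MinProjPres A M) : Subsingleton p.P₁ := by
  obtain ⟨s, hs⟩ := Module.projective_lifting_property p.d₀ LinearMap.id p.surjective
  have hs' : ∀ m, p.d₀ (s m) = m := LinearMap.congr_fun hs
  -- The kernel of `d₀` and the image of `s` span `P₀`, so minimality makes `s` surjective and `d₀`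
  -- injective. Then `d₁ = 0`, and its kernel, all of `P₁`, is superfluous only if `P₁ = 0`.
  have hrange : LinearMap.range s = ⊤ := by
    refine p.superfluous₀ _ (top_le_iff.1 fun x _ => Submodule.mem_sup.2
      ⟨x - s (p.d₀ x), ?_, s (p.d₀ x), ⟨_, rfl⟩, sub_add_cancel _ _⟩)
    rw [LinearMap.mem_ker, map_sub, hs', sub_self]
  have hker : ∀ x, p.d₁ x = 0 := by
    intro x
    obtain ⟨m, hm⟩ := LinearMap.range_eq_top.1 hrange (p.d₁ x)
    have h0 : p.d₀ (p.d₁ x) = 0 := p.exact.apply_apply_eq_zero x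
    rw [← hm, hs'] at h0
    rw [← hm, h0, map_zero]
  have hbot : (⊥ : Submodule A p.P₁) = ⊤ :=
    p.superfluous₁ ⊥ (by rw [sup_bot_eq]; exact eq_top_iff.2 fun x _ => hker x)
  exact (Submodule.subsingleton_iff A).1 (subsingleton_of_bot_eq_top hbot)

variable (K Λ : Type u) [Field K] [Ring Λ] [Algebra K Λ] [Module.Finite K Λ]

/-- Here `P₁ = 0`, so `Tr M` and `τ M` vanish. -/
theorem isTauRigid_of_projective (M : Type u) [AddCommGroup M] [Module Λ M] [Module.Finite Λ M]
    [Module.Projective Λ M] : IsTauRigid K Λ M := by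
  intro g
  have := (minProjPres K Λ M).subsingleton
  refine LinearMap.ext fun m => LinearMap.ext fun x => ?_
  obtain ⟨α, rfl⟩ := Submodule.Quotient.mk_surjective _ x
  rw [Subsingleton.elim α 0, Submodule.Quotient.mk_zero]
  exact map_zero (show TrLeft K Λ M →ₗ[K] K from g m)

theorem isTauInvRigid_of_projective_kDual (M : Type u) [AddCommGroup M] [Module K M] [Module Λ M]
    [IsScalarTower K Λ M] [Module.Finite Λ M] [Module.Projective Λᵐᵒᵖ (KDual K M)] :
    IsTauInvRigid K Λ M := by
  intro g
  have := (minProjPres K Λᵐᵒᵖ (KDual K M)).subsingleton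
  refine LinearMap.ext fun x => ?_
  obtain ⟨α, rfl⟩ := Submodule.Quotient.mk_surjective _ x
  rw [Subsingleton.elim α 0, Submodule.Quotient.mk_zero, map_zero, map_zero]

variable {K Λ}

/-- If `Hom(𝔻Λ, τM) = 0`, then `M` has projective dimension at most one. -/
theorem injective_d₁_of_hom_dReg_tau {M : Type u} [AddCommGroup M] [Module Λ M]
    [Module.Finite Λ M] (h : ∀ g : DReg K Λ →ₗ[Λ] Tau K Λ M, g = 0) :
    Function.Injective (minProjPres K Λ M).d₁ := by
  set p := minProjPres K Λ M
  have := p.finite₁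
  have := p.projective₁
  rw [injective_iff_map_eq_zero]
  intro x hx
  refine (MemAdd.of_projective Λ p.P₁).eq_zero_of_forall fun α => ?_
  -- Evaluation at `x ∈ ker d₁` descends to `Tr M → Λ`, and its dual is a map `𝔻Λ → τ M`. Its
  -- vanishing gives `α x = 0` for every `α : P₁ → Λ`.
  let ev : TrLeft K Λ M →ₗ[Λᵐᵒᵖ] Λ := Submodule.liftQ _
    ({ toFun := fun α => α x
       map_add' := fun _ _ => rfl
       map_smul' := fun _ _ => rfl } : (p.P₁ →ₗ[Λ] Λ) →ₗ[Λᵐᵒᵖ] Λ) (by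
      rintro _ ⟨β, rfl⟩
      change β (p.d₁ x) = 0
      rw [hx, map_zero])
  have h0 := h (KDual.mapLeft K ev)
  refine KDual.eq_zero_of_forall K _ fun φ => ?_
  exact congrArg (fun ψ : Tau K Λ M => ψ (Submodule.Quotient.mk α)) (LinearMap.congr_fun h0 φ)

/-- If `Hom(τ⁻¹M, Λ) = 0`, then `𝔻M` has projective dimension at most one. -/
theorem injective_d₁_of_hom_tauInv_regular {M : Type u} [AddCommGroup M] [Module K M]
    [Module Λ M] [IsScalarTower K Λ M] [Module.Finite Λ M]
    (h : ∀ g : TauInv K Λ M →ₗ[Λ] Λ, g = 0) :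
    Function.Injective (minProjPres K Λᵐᵒᵖ (KDual K M)).d₁ := by
  set p := minProjPres K Λᵐᵒᵖ (KDual K M)
  have := p.finite₁
  have := p.projective₁
  rw [injective_iff_map_eq_zero]
  intro x hx
  have hadd : MemAdd Λᵐᵒᵖ p.P₁ Λ := (MemAdd.of_projective Λᵐᵒᵖ p.P₁).trans
    (MemAdd.of_equiv (MulOpposite.opLinearEquiv Λᵐᵒᵖ).symm)
  refine hadd.eq_zero_of_forall fun α => ?_
  let ev : TauInv K Λ M →ₗ[Λ] Λ := Submodule.liftQ _
    ({ toFun := fun α => α x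
       map_add' := fun _ _ => rfl
       map_smul' := fun _ _ => rfl } : (p.P₁ →ₗ[Λᵐᵒᵖ] Λ) →ₗ[Λ] Λ) (by
      rintro _ ⟨β, rfl⟩
      change β (p.d₁ x) = 0
      rw [hx, map_zero])
  exact LinearMap.congr_fun (h ev) (Submodule.Quotient.mk α)

/-- If `𝔻Λ` is `τ`-rigid and `Ext¹(𝔻Λ, Λ) = 0`, then `𝔻Λ` is projective. -/
theorem projective_dReg_of_isTauRigid (hτ : IsTauRigid K Λ (DReg K Λ))
    (hE : ExtVanishes Λ (DReg K Λ) Λ 1) : Module.Projective Λ (DReg K Λ) := by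
  have hd := injective_d₁_of_hom_dReg_tau hτ
  set p := minProjPres K Λ (DReg K Λ)
  have := p.finite₁
  have := p.projective₁
  have := p.projective₀
  obtain ⟨ι, _, f, g, hfg⟩ := MemAdd.of_projective Λ p.P₁
  -- `Ext¹(𝔻Λ, Λ) = 0` extends each coordinate of `P₁` along `d₁`; together they give a retraction
  -- of `d₁`.
  choose F hF using fun i => hE.exists_extension hd p.exact p.surjective (f i)
  have hr : (∑ i, g i ∘ₗ F i) ∘ₗ p.d₁ = LinearMap.id := by
    refine LinearMap.ext fun x => ?_
    simp only [LinearMap.sum_apply, LinearMap.comp_apply, LinearMap.id_apply]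
    conv_rhs => rw [← MemAdd.sum_apply hfg x]
    exact Finset.sum_congr rfl fun i _ => congrArg (g i) (LinearMap.congr_fun (hF i) x)
  obtain ⟨s, hs⟩ := exists_section_of_retraction p.surjective p.exact hr
  exact Module.Projective.of_split s p.d₀ hs

/-- If `Λ` is `τ⁻¹`-rigid and `Ext¹(𝔻Λ, Λ) = 0`, then `Λ` is self-injective. -/
theorem injective_regular_of_isTauInvRigid (hτ : IsTauInvRigid K Λ Λ)
    (hE : ExtVanishes Λ (DReg K Λ) Λ 1) : Module.Injective Λ Λ := by
  have hd := injective_d₁_of_hom_tauInv_regular hτ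
  set p := minProjPres K Λᵐᵒᵖ (KDual K Λ)
  have := p.finite₁
  have := p.projective₁
  have := p.finite₀
  have := p.projective₀
  let : Module K p.P₁ := Module.compHom p.P₁ (algebraMap K Λᵐᵒᵖ)
  have : IsScalarTower K Λᵐᵒᵖ p.P₁ := isScalarTower_compHom K Λᵐᵒᵖ p.P₁
  let : Module K p.P₀ := Module.compHom p.P₀ (algebraMap K Λᵐᵒᵖ)
  have : IsScalarTower K Λᵐᵒᵖ p.P₀ := isScalarTower_compHom K Λᵐᵒᵖ p.P₀
  have hadd : ∀ (Q : Type u) [AddCommGroup Q] [Module K Q] [Module Λᵐᵒᵖ Q]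
      [IsScalarTower K Λᵐᵒᵖ Q] [Module.Finite Λᵐᵒᵖ Q] [Module.Projective Λᵐᵒᵖ Q],
      MemAdd Λ (KDual K Q) (DReg K Λ) := fun Q _ _ _ _ _ _ =>
    ((MemAdd.of_projective Λᵐᵒᵖ Q).trans
      (MemAdd.of_equiv (MulOpposite.opLinearEquiv Λᵐᵒᵖ).symm)).kDual_left K
  -- The dual of the presentation is `0 → Λ → 𝔻P₀ → 𝔻P₁ → 0`, with both right-hand terms in `add
  -- 𝔻Λ`.
  let a : Λ →ₗ[Λ] KDual K p.P₀ := KDual.mapLeft K p.d₀ ∘ₗ (KDual.evalLeft K Λ).toLinearMap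
  let b : KDual K p.P₀ →ₗ[Λ] KDual K p.P₁ := KDual.mapLeft K p.d₁
  have ha : Function.Injective a :=
    (show Function.Injective (KDual.mapLeft K p.d₀) from
      LinearMap.dualMap_injective_of_surjective (f := p.d₀.restrictScalars K) p.surjective).comp
      (KDual.evalLeft K Λ).injective
  have hb : Function.Surjective b :=
    LinearMap.dualMap_surjective_of_injective (f := p.d₁.restrictScalars K) hd
  have hab : Function.Exact a b := by
    have := KDual.exact_mapLeft (K := K) p.exact
    intro x
    rw [this x]
    constructor
    · rintro ⟨y, rfl⟩
      exact ⟨(KDual.evalLeft K Λ).symm y,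
        congrArg (KDual.mapLeft K p.d₀) ((KDual.evalLeft K Λ).apply_symm_apply y)⟩
    · rintro ⟨y, rfl⟩
      exact ⟨KDual.evalLeft K Λ y, rfl⟩
  obtain ⟨ι, _, f, g, hfg⟩ := hadd p.P₁
  -- Each map `𝔻Λ → 𝔻P₁` lifts along `b`; the lifts assemble to a section, so `Λ` is a summand of
  -- `𝔻P₀`.
  choose G hG using fun i => hE.exists_lift ha hab hb (g i)
  have hs : b ∘ₗ (∑ i, G i ∘ₗ f i) = LinearMap.id := by
    refine LinearMap.ext fun x => ?_
    simp only [LinearMap.sum_apply, LinearMap.comp_apply, LinearMap.id_apply, map_sum]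
    conv_rhs => rw [← MemAdd.sum_apply hfg x]
    exact Finset.sum_congr rfl fun i _ => LinearMap.congr_fun (hG i) (f i x)
  obtain ⟨r, hr⟩ := exists_retraction_of_section ha hab hs
  exact ((MemAdd.of_retract a r hr).trans (hadd p.P₀)).injective

/-- Over a self-injective algebra, the dual of a finitely generated projective left module is
projective. -/
theorem MemAdd.projective_kDual [Module.Injective Λ Λ] {T : Type u} [AddCommGroup T] [Module K T]
    [Module Λ T] [IsScalarTower K Λ T] (h : MemAdd Λ T Λ) :
    Module.Projective Λᵐᵒᵖ (KDual K T) :=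
  (((h.trans (MemAdd.of_injective K Λ Λ)).kDual_right K).trans
    (MemAdd.of_equiv ((KDual.evalRight K Λ).symm.trans
      (MulOpposite.opLinearEquiv Λᵐᵒᵖ)))).projective

end Translations

end FDAlg

/-! ### Characterisations of self-injectivity -/

theorem theorem5p2 (K Λ : Type u) [Field K] [IsAlgClosed K] [Ring Λ] [Algebra K Λ]
    [Module.Finite K Λ] :
    List.TFAE [
      -- (1) `Λ` is self-injective
      Module.Injective Λ Λ,
      -- (2) `𝔻Λ` is semi-Gorenstein projective and `τ`-rigid
      IsSemiGorensteinProjective Λ (DReg K Λ) ∧ IsTauRigid K Λ (DReg K Λ),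
      -- (3) every cotilting module is semi-Gorenstein projective and `τ`-rigid
      ∀ (T : Type u) [AddCommGroup T] [Module Λ T] [Module.Finite Λ T], IsCotilting Λ K T →
        IsSemiGorensteinProjective Λ T ∧ IsTauRigid K Λ T,
      -- (4) `𝔻Λ` is Gorenstein projective
      IsGorensteinProjective Λ (DReg K Λ),
      -- (5) every cotilting module is Gorenstein projective
      ∀ (T : Type u) [AddCommGroup T] [Module Λ T], IsCotilting Λ K T →
        IsGorensteinProjective Λ T,
      -- (6) `Λ` is semi-Gorenstein injective and `τ⁻¹`-rigid
      IsSemiGorensteinInjective Λ K Λ ∧ IsTauInvRigid K Λ Λ,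
      -- (7) every tilting module is semi-Gorenstein injective and `τ⁻¹`-rigid
      ∀ (T : Type u) [AddCommGroup T] [Module K T] [Module Λ T] [IsScalarTower K Λ T]
        [Module.Finite Λ T], IsTilting Λ T →
        IsSemiGorensteinInjective Λ K T ∧ IsTauInvRigid K Λ T,
      -- (8) `Λ` is Gorenstein injective
      IsGorensteinInjective Λ K Λ,
      -- (9) every tilting module is Gorenstein injective
      ∀ (T : Type u) [AddCommGroup T] [Module Λ T], IsTilting Λ T →
        IsGorensteinInjective Λ K T] := by
  tfae_have 1 → 2 := fun _ => by
    have := projective_dReg_of_injective_regular K Λ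
    exact ⟨fun _ hi => extVanishes_of_projective hi, isTauRigid_of_projective K Λ _⟩
  tfae_have 2 → 1 := fun h => by
    have := projective_dReg_of_isTauRigid h.2 (h.1 1 le_rfl)
    exact injective_regular_of_projective_dReg K Λ
  tfae_have 1 → 3 := fun _ T _ _ _ hT => by
    have := projective_dReg_of_injective_regular K Λ
    have := (hT.memAdd_dReg K).projective
    exact ⟨fun _ hi => extVanishes_of_projective hi, isTauRigid_of_projective K Λ _⟩
  tfae_have 3 → 2 := fun h => h (DReg K Λ) (isCotilting_dReg K Λ)
  tfae_have 1 → 5 := fun _ T _ _ hT => by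
    have := projective_dReg_of_injective_regular K Λ
    have := (hT.memAdd_dReg K).projective
    have := hT.finite
    exact isGorensteinProjective_of_projective T
  tfae_have 5 → 4 := fun h => h (DReg K Λ) (isCotilting_dReg K Λ)
  tfae_have 4 → 1 := fun h => by
    have := h.projective
    exact injective_regular_of_projective_dReg K Λ
  tfae_have 1 → 7 := fun _ T _ _ _ _ _ hT => by
    have hadd := hT.memAdd_regular K
    have := hadd.injective
    have := hadd.projective_kDual (K := K)
    exact ⟨fun _ hi => extVanishes_of_injective hi, isTauInvRigid_of_projective_kDual K Λ T⟩
  tfae_have 7 → 6 := fun h => h Λ (isTilting_regular Λ)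
  tfae_have 6 → 1 := fun h => injective_regular_of_isTauInvRigid h.2 (h.1 1 le_rfl)
  tfae_have 1 → 9 := fun _ T _ _ hT => by
    have := (hT.memAdd_regular K).injective
    have := hT.finite
    exact isGorensteinInjective_of_injective K T
  tfae_have 9 → 8 := fun h => h Λ (isTilting_regular Λ)
  tfae_have 8 → 1 := fun h => h.injective
  tfae_finish
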